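/- Let $D=(d_1\ge d_2\ge\dots\ge d_n)$ be the degree sequence of a tree. The greedy tree $G(D)$ is constructed as follows. Label a root and give it degree $d_1$; then repeatedly take the labelled vertex of largest assigned degree whose neighbours are not all labelled yet (the earliest labelled one in case of a tie), label its remaining neighbours (new vertices, as many as its degree requires), and assign to them, in nonincreasing order, the largest entries of $D$ that have not been used yet. For a tree $T$ and real numbers $a,b\ge 0$ put $$W_{a,b}(T)=\sum_{\{v,w\}\subseteq V(T)}\omega(v)\,\omega(w)\,d_T(v,w)=\frac12\sum_{v\in V(T)}\sum_{w\in V(T)}\omega(v)\,\omega(w)\,d_T(v,w),$$ where $d_T$ is the distance in $T$, $\omega(u)=a$ if $u$ is a leaf (a vertex of degree $1$) and $\omega(u)=b$ otherwise. The terminal (respectively spinal) Wiener index of $T$ is the sum of the distances between all unordered pairs of leaves (respectively of non-leaves) of $T$. Theorem. $G(D)$ is a tree with degree sequence $D$, and for every tree $T$ with degree sequence $D$: 1. $W_{a,b}(G(D))\le W_{a,b}(T)$ for all real $a,b>0$; 2. $W_{a,0}(G(D))\le W_{a,0}(T)$ for all $a>0$, and $W_{0,b}(G(D))\le W_{0,b}(T)$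 for all $b>0$; 3. the terminal Wiener index of $G(D)$ is at most that of $T$, and the spinal Wiener index of $G(D)$ is at most that of $T$. -/

import Mathlib

/-- The vertices of the graph can be enumerated in such a way that the `i`-th of them has
degree `d i`. -/
def HasDegreeSequence {V : Type*} [Fintype V] {n : ℕ} (T : SimpleGraph V) [DecidableRel T.Adj]
    (d : Fin n → ℕ) : Prop :=
  ∃ e : Fin n ≃ V, ∀ i, T.degree (e i) = d i

/-- The number of neighbours of the `i`-th labelled vertex that are still unlabelled when the greedy
algorithm comes to process it: all neighbours for the root (vertex `0`), all neighbours but one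
(its parent) for any other vertex. -/
def greedyChildCount {n : ℕ} (d : Fin n → ℕ) (i : Fin n) : ℕ :=
  if (i : ℕ) = 0 then d i else d i - 1

/-- The first label that is still free when the greedy algorithm comes to process vertex `i`: label
`0` went to the root, and the vertices before `i` have labelled their children already. -/
def greedyFirstChild {n : ℕ} (d : Fin n → ℕ) (i : Fin n) : ℕ :=
  1 + ∑ j ∈ Finset.Iio i, greedyChildCount d j

/-- The greedy tree with (nonincreasing) degree sequence `d`. The vertices `0, 1, 2, …` are numbered
in the order in which the greedy algorithm labels them. As the algorithm always hands out the
largest degrees that are available, vertex `i` is assigned the degree `d i`, and the vertex of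
largest degree that is to be processed next (the earliest labelled one, in case of a tie) is always
the first unprocessed one in this order. It is joined to as many new vertices, with consecutive
labels, as its degree requires. -/
def greedyTree {n : ℕ} (d : Fin n → ℕ) : SimpleGraph (Fin n) :=
  SimpleGraph.fromRel fun i k =>
    greedyFirstChild d i ≤ (k : ℕ) ∧ (k : ℕ) < greedyFirstChild d i + greedyChildCount d i

instance greedyTree.instDecidableRelAdj {n : ℕ} (d : Fin n → ℕ) :
    DecidableRel (greedyTree d).Adj := fun i k => by
  unfold greedyTree
  rw [SimpleGraph.fromRel_adj]
  infer_instance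

/-- The weight of a vertex: `a` for leaves, `b` for all other vertices. -/
def leafWeight {V : Type*} [Fintype V] (a b : ℝ) (T : SimpleGraph V) [DecidableRel T.Adj]
    (u : V) : ℝ :=
  if T.degree u = 1 then a else b

/-- The weighted Wiener index: the sum of `ω v * ω w * dist v w` over unordered pairs of vertices,
that is, half of the sum over ordered pairs. -/
noncomputable def weightedWiener {V : Type*} [Fintype V] (a b : ℝ) (T : SimpleGraph V)
    [DecidableRel T.Adj] : ℝ :=
  (1 / 2) * ∑ v, ∑ w, leafWeight a b T v * leafWeight a b T w * (T.dist v w : ℝ)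

/-- The terminal Wiener index: the sum of the distances over unordered pairs of leaves. -/
noncomputable def terminalWiener {V : Type*} [Fintype V] (T : SimpleGraph V)
    [DecidableRel T.Adj] : ℝ :=
  (1 / 2) * ∑ v with T.degree v = 1, ∑ w with T.degree w = 1, (T.dist v w : ℝ)

/-- The spinal Wiener index: the sum of the distances over unordered pairs of non-leaves. -/
noncomputable def spinalWiener {V : Type*} [Fintype V] (T : SimpleGraph V)
    [DecidableRel T.Adj] : ℝ :=
  (1 / 2) * ∑ v with T.degree v ≠ 1, ∑ w with T.degree w ≠ 1, (T.dist v w : ℝ)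

/-! Root a tree at `r`, let B(z) be the total weight of z and its descendants, and let S be the
weight of the whole tree. The edge above z separates weight B(z) from S - B(z), so the index is the
sum of B(z)(S - B(z)) over all z, the root contributing 0 (`sum_mul_dist_eq`).

Root T at a weighted centroid: then B(z) ≤ S/2 for z ≠ r, where t(S - t) is concave and
nondecreasing. List the vertices of T by decreasing B and those of the greedy tree by label, with
values y and x. Since y(S - y) - x(S - x) ≥ (S - 2y)(y - x), Abel summation reduces the theorem to
one claim: every tail sum of y is at least that of x (`tail_greedyTree_le`). The root of the greedy
tree need not be a centroid.

For the claim, the degrees determine B(z) up to the shape of the branch: B(z) is `a` plus the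
`excessWeight` of the vertices below, a nonnegative nondecreasing function of the degree
(`branchWeight_eq`). The first j vertices form a set s closed under parents, so a tail sum is a
constant plus the sum of excess(deg u) times the number of ancestors of u outside s, the level of u.
In the greedy tree the most vertices, and those of largest degree, lie within each level;
`levelBound` is the resulting bound, placed between the two trees.

All of this works for `a, b ≥ 0`, so zero weights need no limit argument. -/

open Finset

/-! ### Rooted trees: ancestors and distances -/

/-- `G` is the tree with root `r` in which `p` sends every vertex other than the root to its
parent; `rk` is a rank function witnessing that `p` leads to the root. -/
structure IsParentMap {V : Type*} (G : SimpleGraph V) (r : V) (p : V → V) (rk : V → ℕ) :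
    Prop where
  map_root : p r = r
  rank_lt : ∀ v, v ≠ r → rk (p v) < rk v
  adj_iff : ∀ u v, G.Adj u v ↔ (u ≠ r ∧ p u = v) ∨ (v ≠ r ∧ p v = u)

open Classical in
/-- The vertices on the way from `u` to the root, `u` and the root included. -/
noncomputable def ancestors {V : Type*} [Fintype V] (p : V → V) (u : V) : Finset V :=
  {v | ∃ k, p^[k] u = v}

theorem mem_ancestors {V : Type*} [Fintype V] {p : V → V} {u v : V} :
    v ∈ ancestors p u ↔ ∃ k, p^[k] u = v := by
  simp [ancestors]

theorem mem_ancestors_iff {V : Type*} [Fintype V] {p : V → V} {u v : V} :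
    v ∈ ancestors p u ↔ v = u ∨ v ∈ ancestors p (p u) := by
  simp only [mem_ancestors]
  constructor
  · rintro ⟨k, rfl⟩
    cases k with
    | zero => exact Or.inl rfl
    | succ k => exact Or.inr ⟨k, rfl⟩
  · rintro (rfl | ⟨k, rfl⟩)
    · exact ⟨0, rfl⟩
    · exact ⟨k + 1, rfl⟩

theorem self_mem_ancestors {V : Type*} [Fintype V] (p : V → V) (u : V) : u ∈ ancestors p u :=
  mem_ancestors_iff.2 (Or.inl rfl)

theorem ancestors_eq_insert {V : Type*} [Fintype V] [DecidableEq V] (p : V → V) (u : V) :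
    ancestors p u = insert u (ancestors p (p u)) := by
  ext v
  rw [mem_ancestors_iff, mem_insert]

theorem mem_ancestors_trans {V : Type*} [Fintype V] {p : V → V} {u v w : V}
    (huv : v ∈ ancestors p u) (hvw : w ∈ ancestors p v) : w ∈ ancestors p u := by
  rw [mem_ancestors] at *
  obtain ⟨k, rfl⟩ := huv
  obtain ⟨l, rfl⟩ := hvw
  exact ⟨l + k, Function.iterate_add_apply p l k u⟩

/-- The total weight of the branch at `z`, that is, of `z` and its descendants. -/
noncomputable def branchWeight {V : Type*} [Fintype V] [DecidableEq V] (p : V → V) (ω : V → ℝ)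
    (z : V) : ℝ :=
  ∑ u, if z ∈ ancestors p u then ω u else 0

namespace IsParentMap

variable {V : Type*} {G : SimpleGraph V} {r : V} {p : V → V} {rk : V → ℕ}

theorem induction (h : IsParentMap G r p rk) {P : V → Prop} (root : P r)
    (step : ∀ v, v ≠ r → P (p v) → P v) (v : V) : P v := by
  induction hN : rk v using Nat.strong_induction_on generalizing v with
  | _ N ih =>
    by_cases hv : v = r
    · exact hv ▸ root
    · exact step v hv (ih _ (hN ▸ h.rank_lt v hv) _ rfl)

variable [Fintype V]

theorem rank_le (h : IsParentMap G r p rk) {u v : V} (huv : v ∈ ancestors p u) :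
    rk v ≤ rk u := by
  rw [mem_ancestors] at huv
  obtain ⟨k, rfl⟩ := huv
  induction k with
  | zero => exact le_rfl
  | succ k ih =>
    rw [Function.iterate_succ_apply']
    by_cases hk : p^[k] u = r
    · rwa [hk, h.map_root, ← hk]
    · exact (h.rank_lt _ hk).le.trans ih

theorem notMem_ancestors_parent (h : IsParentMap G r p rk) {u : V} (hu : u ≠ r) :
    u ∉ ancestors p (p u) :=
  fun hm => (h.rank_le hm).not_gt (h.rank_lt u hu)

theorem mem_ancestors_root (h : IsParentMap G r p rk) {v : V} :
    v ∈ ancestors p r ↔ v = r := by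
  rw [mem_ancestors]
  constructor
  · rintro ⟨k, rfl⟩
    exact Function.iterate_fixed h.map_root k
  · rintro rfl
    exact ⟨0, rfl⟩

theorem root_mem_ancestors (h : IsParentMap G r p rk) (u : V) : r ∈ ancestors p u :=
  h.induction (P := fun u => r ∈ ancestors p u) (self_mem_ancestors p r)
    (fun _ _ ih => mem_ancestors_iff.2 (Or.inr ih)) u

theorem rank_lt_of_mem (h : IsParentMap G r p rk) {u v : V} (huv : v ∈ ancestors p u)
    (hne : v ≠ u) : rk v < rk u := by
  have hu : u ≠ r := by
    rintro rfl
    exact hne (h.mem_ancestors_root.1 huv)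
  have := (mem_ancestors_iff.1 huv).resolve_left hne
  exact (h.rank_le this).trans_lt (h.rank_lt u hu)

variable [DecidableEq V]

theorem card_symmDiff_le_one (h : IsParentMap G r p rk) {u v : V} (huv : G.Adj u v) :
    #(symmDiff (ancestors p u) (ancestors p v)) ≤ 1 := by
  have key : ∀ w, #(symmDiff (ancestors p w) (ancestors p (p w))) ≤ 1 := by
    intro w
    refine (card_le_card (t := {w}) fun x hx => ?_).trans (card_singleton w).le
    rw [mem_symmDiff, mem_ancestors_iff (u := w)] at hx
    rw [mem_singleton]
    tauto
  rcases (h.adj_iff u v).1 huv with ⟨-, rfl⟩ | ⟨-, rfl⟩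
  · exact key u
  · rw [symmDiff_comm]
    exact key v

theorem card_symmDiff_le_length (h : IsParentMap G r p rk) {u w : V} (q : G.Walk u w) :
    #(symmDiff (ancestors p u) (ancestors p w)) ≤ q.length := by
  induction q with
  | nil => simp
  | @cons u v w huv q ih =>
    have h1 := card_le_card (symmDiff_triangle (ancestors p u) (ancestors p v) (ancestors p w))
    have h2 := card_union_le (symmDiff (ancestors p u) (ancestors p v))
      (symmDiff (ancestors p v) (ancestors p w))
    have h3 := h.card_symmDiff_le_one huv
    rw [SimpleGraph.Walk.length_cons]
    rw [sup_eq_union] at h1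
    omega

/-- The endpoint of larger rank is not an ancestor of the other one, so replacing it by its parent
removes exactly that vertex from the symmetric difference. -/
theorem exists_walk_length_le (h : IsParentMap G r p rk) (u w : V) :
    ∃ q : G.Walk u w, q.length ≤ #(symmDiff (ancestors p u) (ancestors p w)) := by
  induction hN : rk u + rk w using Nat.strong_induction_on generalizing u w with
  | _ N ih =>
    have step : ∀ u w, rk u + rk w = N → u ≠ w → rk w ≤ rk u →
        ∃ q : G.Walk u w, q.length ≤ #(symmDiff (ancestors p u) (ancestors p w)) := by
      intro u w hN hne hle
      have hu : u ∉ ancestors p w := fun hm => (h.rank_lt_of_mem hm hne).not_ge hle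
      have hur : u ≠ r := by
        rintro rfl
        exact hu (h.root_mem_ancestors w)
      have hlt := h.rank_lt u hur
      obtain ⟨q, hq⟩ := ih (rk (p u) + rk w) (by omega) (p u) w rfl
      refine ⟨.cons ((h.adj_iff u (p u)).2 (Or.inl ⟨hur, rfl⟩)) q, ?_⟩
      rw [SimpleGraph.Walk.length_cons]
      have hnot : u ∉ symmDiff (ancestors p (p u)) (ancestors p w) := by
        rw [mem_symmDiff]
        have := h.notMem_ancestors_parent hur
        tauto
      refine (Nat.add_le_add_right hq 1).trans ?_
      rw [← card_insert_of_notMem hnot]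
      refine card_le_card fun x hx => ?_
      rw [mem_insert, mem_symmDiff] at hx
      rw [mem_symmDiff, mem_ancestors_iff (u := u)]
      rcases hx with rfl | hx
      · tauto
      · by_cases hxu : x = u
        · subst hxu
          tauto
        · tauto
    by_cases hne : u = w
    · subst hne
      exact ⟨.nil, by simp⟩
    · rcases le_total (rk w) (rk u) with hle | hle
      · exact step u w hN hne hle
      · obtain ⟨q, hq⟩ := step w u (by omega) (Ne.symm hne) hle
        exact ⟨q.reverse, by rwa [SimpleGraph.Walk.length_reverse, symmDiff_comm]⟩

theorem connected (h : IsParentMap G r p rk) : G.Connected :=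
  haveI : Nonempty V := ⟨r⟩
  ⟨fun u w => ⟨(h.exists_walk_length_le u w).choose⟩⟩

theorem dist_eq (h : IsParentMap G r p rk) (u w : V) :
    G.dist u w = #(symmDiff (ancestors p u) (ancestors p w)) := by
  apply le_antisymm
  · obtain ⟨q, hq⟩ := h.exists_walk_length_le u w
    exact (SimpleGraph.dist_le q).trans hq
  · obtain ⟨q, hq⟩ := h.connected.exists_walk_length_eq_dist u w
    exact hq ▸ h.card_symmDiff_le_length q

theorem dist_eq_sum (h : IsParentMap G r p rk) (u w : V) :
    (G.dist u w : ℝ) = ∑ z, ((if z ∈ ancestors p u then (1 : ℝ) else 0) +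
      (if z ∈ ancestors p w then 1 else 0) -
      2 * ((if z ∈ ancestors p u then 1 else 0) * (if z ∈ ancestors p w then 1 else 0))) := by
  rw [h.dist_eq, ← filter_univ_mem (symmDiff _ _), card_filter, Nat.cast_sum]
  refine sum_congr rfl fun z _ => ?_
  simp only [mem_symmDiff]
  by_cases hu : z ∈ ancestors p u <;> by_cases hw : z ∈ ancestors p w <;> (simp [hu, hw]; try norm_num)

end IsParentMap

/-! ### The Wiener index in terms of branch weights -/

theorem branchWeight_mono {V : Type*} [Fintype V] [DecidableEq V] {p : V → V} {ω : V → ℝ}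
    (hω : ∀ u, 0 ≤ ω u) {y z : V} (hyz : z ∈ ancestors p y) :
    branchWeight p ω y ≤ branchWeight p ω z := by
  refine sum_le_sum fun u _ => ?_
  by_cases hy : y ∈ ancestors p u
  · rw [if_pos hy, if_pos (mem_ancestors_trans hy hyz)]
  · rw [if_neg hy]
    split_ifs
    exacts [hω u, le_rfl]

namespace IsParentMap

variable {V : Type*} {G : SimpleGraph V} {r : V} {p : V → V} {rk : V → ℕ} [Fintype V]
  [DecidableEq V]

theorem branchWeight_root (h : IsParentMap G r p rk) (ω : V → ℝ) :
    branchWeight p ω r = ∑ u, ω u :=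
  sum_congr rfl fun u _ => if_pos (h.root_mem_ancestors u)

/-- The distance counts the z whose branch contains exactly one of u and w. Exchanging sums, each z
separates its branch from the rest; the factor 2 comes from ordered pairs. -/
theorem sum_mul_dist_eq (h : IsParentMap G r p rk) (ω : V → ℝ) :
    ∑ u, ∑ w, ω u * ω w * (G.dist u w : ℝ) =
      2 * ∑ z, branchWeight p ω z * (∑ u, ω u - branchWeight p ω z) := by
  have hb : ∀ z, branchWeight p ω z = ∑ u, ω u * (if z ∈ ancestors p u then (1 : ℝ) else 0) :=
    fun z => sum_congr rfl fun u _ => by simp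
  have key : ∀ z, ∑ u, ∑ w, ω u * ω w * ((if z ∈ ancestors p u then (1 : ℝ) else 0) +
      (if z ∈ ancestors p w then 1 else 0) -
      2 * ((if z ∈ ancestors p u then 1 else 0) * (if z ∈ ancestors p w then 1 else 0))) =
      2 * (branchWeight p ω z * (∑ u, ω u - branchWeight p ω z)) := by
    intro z
    rw [hb]
    generalize hχ : (fun u => if z ∈ ancestors p u then (1 : ℝ) else 0) = χ
    simp only [funext_iff] at hχ
    simp only [hχ]
    have : 2 * ((∑ u, ω u * χ u) * (∑ u, ω u - ∑ u, ω u * χ u)) =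
        (∑ u, ω u * χ u) * (∑ w, ω w) + (∑ u, ω u) * (∑ w, ω w * χ w) -
          2 * ((∑ u, ω u * χ u) * (∑ w, ω w * χ w)) := by ring
    rw [this, sum_mul_sum, sum_mul_sum, sum_mul_sum, mul_sum, ← sum_add_distrib,
      ← sum_sub_distrib]
    refine sum_congr rfl fun u _ => ?_
    rw [mul_sum, ← sum_add_distrib, ← sum_sub_distrib]
    exact sum_congr rfl fun w _ => by ring
  simp only [h.dist_eq_sum, mul_sum (univ : Finset V) _ (ω _ * ω _)]
  rw [mul_sum, ← sum_congr rfl fun z _ => key z, sum_comm]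
  rw [sum_congr rfl fun w _ => sum_comm, sum_comm]
  rw [sum_congr rfl fun w _ => sum_comm]

variable [DecidableRel G.Adj]

/-- Every vertex is adjacent to its children and, unless it is the root, to its parent. -/
theorem degree_eq (h : IsParentMap G r p rk) (v : V) :
    G.degree v = #{w | w ≠ r ∧ p w = v} + if v = r then 0 else 1 := by
  have hN : G.neighborFinset v =
      ({w | w ≠ r ∧ p w = v} : Finset V) ∪ if v = r then ∅ else {p v} := by
    ext w
    rw [SimpleGraph.mem_neighborFinset, h.adj_iff, mem_union, mem_filter_univ]
    by_cases hv : v = r <;> simp [hv, or_comm, eq_comm]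
  rw [← SimpleGraph.card_neighborFinset_eq_degree, hN, card_union_of_disjoint]
  · split_ifs <;> simp
  · split_ifs with hv
    · simp
    · rw [disjoint_singleton_right, mem_filter_univ]
      rintro ⟨hp, hpp⟩
      have h1 := h.rank_lt _ hp
      have h2 := h.rank_lt _ hv
      rw [hpp] at h1
      exact h1.asymm h2

theorem sum_card_children (s : Finset V) :
    ∑ v ∈ s, #{w | w ≠ r ∧ p w = v} = #{w | w ≠ r ∧ p w ∈ s} := by
  rw [card_eq_sum_card_fiberwise (t := s) (f := p)]
  · refine sum_congr rfl fun v hv => ?_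
    rw [filter_filter]
    congr 1
    ext w
    simp only [mem_filter_univ]
    constructor
    · rintro ⟨h1, rfl⟩
      exact ⟨⟨h1, hv⟩, rfl⟩
    · rintro ⟨⟨h1, -⟩, h2⟩
      exact ⟨h1, h2⟩
  · intro w hw
    simp at hw
    exact hw.2

/-- Away from the root, 2 - deg u is 1 minus the number of children, and the children of vertices of
the branch are all its vertices except z. -/
theorem sum_two_sub_degree (h : IsParentMap G r p rk) {z : V} (hz : z ≠ r) :
    (∑ u, if z ∈ ancestors p u then (2 : ℝ) - G.degree u else 0) = 1 := by
  rw [← sum_filter]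
  set s : Finset V := {u | z ∈ ancestors p u} with hs
  have hsr : ∀ u ∈ s, u ≠ r := by
    rintro u hu rfl
    rw [hs, mem_filter_univ, h.mem_ancestors_root] at hu
    exact hz hu
  have hz' : z ∈ s := by
    rw [hs, mem_filter_univ]
    exact self_mem_ancestors p z
  have hch : ({w | w ≠ r ∧ p w ∈ s} : Finset V) = s.erase z := by
    ext w
    rw [mem_filter_univ, mem_erase]
    constructor
    · rintro ⟨hw, hpw⟩
      rw [hs, mem_filter_univ] at hpw ⊢
      refine ⟨?_, mem_ancestors_iff.2 (Or.inr hpw)⟩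
      rintro rfl
      exact h.notMem_ancestors_parent hw hpw
    · rintro ⟨hwz, hw⟩
      refine ⟨hsr w hw, ?_⟩
      rw [hs, mem_filter_univ] at hw ⊢
      exact (mem_ancestors_iff.1 hw).resolve_left (Ne.symm hwz)
  have hsum : (∑ u ∈ s, (#{w | w ≠ r ∧ p w = u} : ℝ)) = #s - 1 := by
    rw [← Nat.cast_sum, sum_card_children, hch, card_erase_of_mem hz',
      Nat.cast_sub (card_pos.2 ⟨z, hz'⟩), Nat.cast_one]
  calc ∑ u ∈ s, ((2 : ℝ) - G.degree u)
      = ∑ u ∈ s, ((1 : ℝ) - #{w | w ≠ r ∧ p w = u}) := by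
        refine sum_congr rfl fun u hu => ?_
        rw [h.degree_eq, if_neg (hsr u hu)]
        push_cast
        ring
    _ = 1 := by
        rw [sum_sub_distrib, hsum]
        simp

end IsParentMap

/-- The weight that an internal vertex of degree `d` contributes to the branches containing it,
once each branch has been given the weight `a` in advance. -/
def excessWeight (a b : ℝ) (d : ℕ) : ℝ :=
  if d ≤ 1 then 0 else a * (d - 2) + b

theorem excessWeight_mono {a b : ℝ} (ha : 0 ≤ a) (hb : 0 ≤ b) : Monotone (excessWeight a b) := by
  intro d e hde
  unfold excessWeight
  split_ifs with h1 h2 h2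
  · exact le_rfl
  · have : (2 : ℝ) ≤ e := by exact_mod_cast (by omega : 2 ≤ e)
    have := mul_nonneg ha (sub_nonneg.2 this)
    linarith
  · omega
  · have : (d : ℝ) ≤ e := by exact_mod_cast hde
    gcongr

namespace IsParentMap

variable {V : Type*} {G : SimpleGraph V} {r : V} {p : V → V} {rk : V → ℕ} [Fintype V]
  [DecidableEq V] [DecidableRel G.Adj]

/-- Away from the root the weight of u is a(2 - deg u) plus its excess, for leaves and internal
vertices alike; the first terms add up to `a` over the branch. -/
theorem branchWeight_eq (h : IsParentMap G r p rk) (a b : ℝ) {z : V} (hz : z ≠ r) :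
    branchWeight p (leafWeight a b G) z =
      a + ∑ u, if z ∈ ancestors p u then excessWeight a b (G.degree u) else 0 := by
  have ha := congrArg (a * ·) (h.sum_two_sub_degree hz)
  simp only [mul_one, mul_sum] at ha
  conv_rhs => enter [1]; rw [← ha]
  rw [← sum_add_distrib, branchWeight]
  refine sum_congr rfl fun u _ => ?_
  by_cases hu : z ∈ ancestors p u
  · have hur : u ≠ r := by
      rintro rfl
      exact hz (h.mem_ancestors_root.1 hu)
    have hdeg : 1 ≤ G.degree u := by
      rw [h.degree_eq, if_neg hur]
      omega
    simp only [if_pos hu, leafWeight, excessWeight]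
    by_cases h1 : G.degree u = 1
    · simp [h1]
      ring
    · rw [if_neg h1, if_neg (by omega)]
      ring
  · simp [hu]

/-- The sum of the branch weights outside a set of vertices containing the root. -/
theorem sum_branchWeight_compl (h : IsParentMap G r p rk) (a b : ℝ) {s : Finset V} (hr : r ∈ s) :
    ∑ z ∈ sᶜ, branchWeight p (leafWeight a b G) z =
      a * #sᶜ + ∑ u, excessWeight a b (G.degree u) * #(ancestors p u \ s) := by
  have h1 : ∀ z ∈ sᶜ, branchWeight p (leafWeight a b G) z =
      a + ∑ u, if z ∈ ancestors p u then excessWeight a b (G.degree u) else 0 := by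
    intro z hz
    apply h.branchWeight_eq
    rintro rfl
    exact mem_compl.1 hz hr
  rw [sum_congr rfl h1, sum_add_distrib, sum_comm, sum_const, nsmul_eq_mul, mul_comm a]
  congr 1
  refine sum_congr rfl fun u _ => ?_
  rw [← sum_filter, sum_const, nsmul_eq_mul, mul_comm]
  congr 3
  ext z
  simp [and_comm]

end IsParentMap

/-! ### Rearrangement and Abel summation -/

/-- Among all sets of a given size, an initial segment maximizes the sum of an antitone function. -/
theorem sum_le_sum_initial {n : ℕ} {f : Fin n → ℝ} (hf : Antitone f) (s : Finset (Fin n)) :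
    ∑ i ∈ s, f i ≤ ∑ i with i.val < #s, f i := by
  set t : Finset (Fin n) := {i | i.val < #s} with ht
  have hsn : #s ≤ n := by simpa using card_le_univ s
  have hcard : #t = #s := by
    rw [ht, Fin.card_filter_val_lt, min_eq_right hsn]
  rcases hsn.lt_or_eq with hlt | heq
  -- The differences `s \ t` and `t \ s` have equal size, and the value of `f` at the threshold `#s`
  -- separates them.
  · have h1 : ∑ i ∈ s \ t, f i ≤ #(s \ t) • f ⟨#s, hlt⟩ := by
      refine sum_le_card_nsmul _ _ _ fun i hi => hf ?_
      rw [mem_sdiff, ht, mem_filter_univ, not_lt] at hi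
      exact hi.2
    have h2 : #(t \ s) • f ⟨#s, hlt⟩ ≤ ∑ i ∈ t \ s, f i := by
      refine card_nsmul_le_sum _ _ _ fun i hi => hf ?_
      rw [mem_sdiff, ht, mem_filter_univ] at hi
      exact hi.1.le
    rw [card_sdiff_comm hcard] at h2
    have h3 := sum_inter_add_sum_sdiff s t f
    have h4 := sum_inter_add_sum_sdiff t s f
    rw [inter_comm] at h4
    linarith
  · have hs : s = univ := by
      rw [← card_eq_iff_eq_univ, Fintype.card_fin, heq]
    have ht' : t = univ := by
      rw [← card_eq_iff_eq_univ, Fintype.card_fin, hcard, heq]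
    rw [ht', hs]

theorem sum_degree_le_sum_initial {V : Type*} [Fintype V] {G : SimpleGraph V}
    [DecidableRel G.Adj] {n : ℕ} {d : Fin n → ℕ} (hd : Antitone d) {e : Fin n ≃ V}
    (he : ∀ i, G.degree (e i) = d i) {f : ℕ → ℝ} (hf : Monotone f) (s : Finset V) :
    ∑ v ∈ s, f (G.degree v) ≤ ∑ i with i.val < #s, f (d i) := by
  have h := sum_le_sum_initial (hf.comp_antitone hd) (s.map e.symm.toEmbedding)
  rw [sum_map, card_map] at h
  refine le_of_eq_of_le (sum_congr rfl fun v _ => ?_) h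
  have := he (e.symm v)
  rw [e.apply_symm_apply] at this
  rw [this]
  rfl

theorem sum_degree_eq {V : Type*} [Fintype V] {G : SimpleGraph V}
    [DecidableRel G.Adj] {n : ℕ} {d : Fin n → ℕ} {e : Fin n ≃ V}
    (he : ∀ i, G.degree (e i) = d i) {M : Type*} [AddCommMonoid M] (f : ℕ → M) :
    ∑ v, f (G.degree v) = ∑ i, f (d i) := by
  rw [← e.sum_comp]
  simp [he]

/-- Abel summation: a nonnegative monotone sequence has a nonnegative product with every sequence
whose tails have nonnegative sums. -/
theorem sum_mul_nonneg_of_tails {n : ℕ} {c g : Fin n → ℝ} (hc : Monotone c) (hc0 : ∀ i, 0 ≤ c i)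
    (hg : ∀ j : ℕ, j < n → 0 ≤ ∑ i with j ≤ Fin.val i, g i) : 0 ≤ ∑ i, c i * g i := by
  induction n with
  | zero => simp
  | succ n ih =>
    have h1 := ih (c := fun i => c i.succ - c 0) (g := fun i => g i.succ)
      (fun i j hij => sub_le_sub_right (hc (Fin.succ_le_succ_iff.2 hij)) _)
      (fun i => sub_nonneg.2 (hc (Fin.zero_le _))) fun j hj => by
        have := hg (j + 1) (by omega)
        rw [sum_filter, Fin.sum_univ_succ] at this
        rw [sum_filter]
        simpa using this
    have h2 : 0 ≤ ∑ i, g i := by simpa using hg 0 (by omega)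
    have h3 : ∑ i, c i * g i = c 0 * ∑ i, g i + ∑ i : Fin n, (c i.succ - c 0) * g i.succ := by
      rw [Fin.sum_univ_succ, Fin.sum_univ_succ, mul_add, mul_sum, add_assoc, ← sum_add_distrib]
      congr 1
      exact sum_congr rfl fun i _ => by ring
    rw [h3]
    have := mul_nonneg (hc0 0) h2
    positivity

/-! ### Levels and their extremal sizes -/

/-- The number of vertices labelled by the greedy algorithm once the first `m` vertices have been
processed. -/
def greedyLabelled {n : ℕ} (d : Fin n → ℕ) (m : ℕ) : ℕ :=
  1 + ∑ i with i.val < m, greedyChildCount d i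

theorem greedyFirstChild_eq {n : ℕ} (d : Fin n → ℕ) (i : Fin n) :
    greedyFirstChild d i = greedyLabelled d i := by
  unfold greedyFirstChild greedyLabelled
  congr 2
  ext j
  rw [mem_Iio, mem_filter_univ, Fin.lt_def]

theorem greedyLabelled_mono {n : ℕ} (d : Fin n → ℕ) : Monotone (greedyLabelled d) := by
  intro l m hlm
  unfold greedyLabelled
  gcongr

theorem greedyLabelled_succ {n : ℕ} (d : Fin n → ℕ) (i : Fin n) :
    greedyLabelled d (i + 1) = greedyLabelled d i + greedyChildCount d i := by
  unfold greedyLabelled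
  have : ({j | j.val < i.val + 1} : Finset (Fin n)) = insert i ({j | j.val < i.val} : Finset _) := by
    ext j
    rw [mem_insert, mem_filter_univ, mem_filter_univ, Fin.ext_iff]
    omega
  rw [this, sum_insert (by simp)]
  ring

/-- The root has `d 0` children and every other vertex one fewer than its degree. Positivity makes
the truncated subtraction exact; the root is exempt because of the one-vertex tree. -/
theorem greedyLabelled_eq {n : ℕ} (d : Fin n → ℕ) (hpos : ∀ i : Fin n, i.val ≠ 0 → 1 ≤ d i)
    {m : ℕ} (hm : 1 ≤ m) (hmn : m ≤ n) :
    greedyLabelled d m + m = 2 + ∑ i with i.val < m, d i := by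
  induction m, hm using Nat.le_induction with
  | base =>
    have : ({j | j.val < 1} : Finset (Fin n)) = {⟨0, hmn⟩} := by
      ext j
      simp [Fin.ext_iff]
    rw [greedyLabelled, this, sum_singleton, sum_singleton, greedyChildCount, if_pos rfl]
    ring
  | succ m hm ih =>
    have h1 := greedyLabelled_succ d ⟨m, hmn⟩
    have h2 := ih (by omega)
    have h3 : ({j | j.val < m + 1} : Finset (Fin n)) =
        insert ⟨m, hmn⟩ ({j | j.val < m} : Finset (Fin n)) := by
      ext j
      rw [mem_insert, mem_filter_univ, mem_filter_univ, Fin.ext_iff]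
      dsimp only
      omega
    rw [h3, sum_insert (by simp)]
    have h4 := hpos ⟨m, hmn⟩ (by simp; omega)
    rw [greedyChildCount, if_neg (by simp; omega)] at h1
    simp only at h1
    omega

/-- The lower bound for a sum of levels, weighted by `f` of the degrees, over the trees with degree
sequence `d`: the number of vertices up to level `l` is at most what the greedy tree achieves. -/
noncomputable def levelBound {n : ℕ} (d : Fin n → ℕ) (f : ℕ → ℝ) (j : ℕ) : ℝ :=
  ∑ l ∈ range n, (∑ i, f (d i) - ∑ i with i.val < (greedyLabelled d)^[l] j, f (d i))

/-- Layer-cake summation: u is counted once for each l below its level. -/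
theorem sum_mul_eq_sum_levels {V : Type*} [Fintype V] (f : V → ℝ) (lev : V → ℕ) {n : ℕ}
    (hlev : ∀ u, lev u ≤ n) :
    ∑ u, f u * lev u = ∑ l ∈ range n, (∑ u, f u - ∑ u with lev u ≤ l, f u) := by
  have h1 : ∀ l, ∑ u, f u - ∑ u with lev u ≤ l, f u = ∑ u, if l < lev u then f u else 0 := by
    intro l
    rw [sum_filter, ← sum_sub_distrib]
    refine sum_congr rfl fun u _ => ?_
    by_cases h : lev u ≤ l
    · simp [h, h.not_gt]
    · simp [h, not_le.1 h]
  simp only [h1]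
  rw [sum_comm]
  refine sum_congr rfl fun u _ => ?_
  rw [← sum_filter, sum_const, nsmul_eq_mul, mul_comm]
  congr 2
  have : ({l ∈ range n | l < lev u}) = range (lev u) := by
    ext l
    have := hlev u
    simp only [mem_filter, mem_range]
    omega
  rw [this, card_range]

namespace IsParentMap

variable {V : Type*} {G : SimpleGraph V} {r : V} {p : V → V} {rk : V → ℕ} [Fintype V]
  [DecidableEq V]

theorem level_parent_lt (h : IsParentMap G r p rk) {s : Finset V} {u : V} (hu : u ∉ s)
    (hr : r ∈ s) : #(ancestors p (p u) \ s) + 1 = #(ancestors p u \ s) := by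
  have hur : u ≠ r := by
    rintro rfl
    exact hu hr
  rw [ancestors_eq_insert p u, insert_sdiff_of_notMem _ hu, card_insert_of_notMem]
  rw [mem_sdiff]
  exact fun hm => h.notMem_ancestors_parent hur hm.1

theorem level_eq_zero {s : Finset V} (hs : ∀ u ∈ s, p u ∈ s) {u : V} (hu : u ∈ s) :
    #(ancestors p u \ s) = 0 := by
  rw [card_eq_zero, sdiff_eq_empty_iff_subset]
  intro v hv
  obtain ⟨k, rfl⟩ := mem_ancestors.1 hv
  clear hv
  induction k with
  | zero => exact hu
  | succ k ih =>
    rw [Function.iterate_succ_apply']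
    exact hs _ ih

variable [DecidableRel G.Adj] {n : ℕ} {d : Fin n → ℕ} {e : Fin n ≃ V}

/-- If t is the set of vertices of level at most l, the next set consists at most of the root and
the children of t. Their number is 2 + Σ deg - #t over t, which is largest for the #t largest
degrees, where it equals `greedyLabelled d #t`. -/
theorem card_level_le (h : IsParentMap G r p rk) (hd : Antitone d)
    (he : ∀ i, G.degree (e i) = d i) (hpos : ∀ i : Fin n, i.val ≠ 0 → 1 ≤ d i) {s : Finset V}
    (hr : r ∈ s) (hs : ∀ u ∈ s, p u ∈ s) (l : ℕ) :
    #{u | #(ancestors p u \ s) ≤ l} ≤ (greedyLabelled d)^[l] #s := by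
  have hn : Fintype.card V = n := by simpa using (Fintype.card_congr e).symm
  induction l with
  | zero =>
    refine card_le_card fun u hu => ?_
    rw [mem_filter_univ, Nat.le_zero, card_eq_zero, sdiff_eq_empty_iff_subset] at hu
    exact hu (self_mem_ancestors p u)
  | succ l ih =>
    rw [Function.iterate_succ_apply']
    refine le_trans ?_ (greedyLabelled_mono d ih)
    set t : Finset V := {u | #(ancestors p u \ s) ≤ l} with ht
    have hrt : r ∈ t := by
      rw [ht, mem_filter_univ, level_eq_zero hs hr]
      exact Nat.zero_le l
    have hsub : ({u | #(ancestors p u \ s) ≤ l + 1} : Finset V) ⊆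
        insert r ({w | w ≠ r ∧ p w ∈ t} : Finset V) := by
      intro u hu
      rw [mem_filter_univ] at hu
      rw [mem_insert, mem_filter_univ]
      by_cases hur : u = r
      · exact Or.inl hur
      · refine Or.inr ⟨hur, ?_⟩
        rw [ht, mem_filter_univ]
        by_cases hus : u ∈ s
        · rw [level_eq_zero hs (hs u hus)]
          exact Nat.zero_le l
        · have := h.level_parent_lt hus hr
          omega
    have hcard := (card_le_card hsub).trans (card_insert_le _ _)
    have hdeg : ∑ v ∈ t, G.degree v + 1 = #{w | w ≠ r ∧ p w ∈ t} + #t := by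
      rw [sum_congr rfl fun v _ => h.degree_eq v, sum_add_distrib, sum_card_children, add_assoc,
        ← sum_erase_add t _ hrt, if_pos rfl, sum_congr rfl (g := fun _ => 1), sum_const,
        smul_eq_mul, mul_one, card_erase_of_mem hrt]
      · have := card_pos.2 ⟨r, hrt⟩
        omega
      · intro v hv
        rw [if_neg (ne_of_mem_erase hv)]
    have htop := sum_degree_le_sum_initial hd he (f := fun m => (m : ℝ)) Nat.mono_cast t
    rw [← Nat.cast_sum, ← Nat.cast_sum, Nat.cast_le] at htop
    have := greedyLabelled_eq d hpos (card_pos.2 ⟨r, hrt⟩)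
      ((card_le_univ t).trans hn.le)
    omega

/-- In each layer, the vertices of level at most l are no more numerous than in the bound, and their
degrees are dominated by the largest entries of `d`. -/
theorem levelBound_le (h : IsParentMap G r p rk) (hd : Antitone d)
    (he : ∀ i, G.degree (e i) = d i) (hpos : ∀ i : Fin n, i.val ≠ 0 → 1 ≤ d i) {f : ℕ → ℝ}
    (hf : Monotone f) (hf0 : ∀ m, 0 ≤ f m) {s : Finset V} (hr : r ∈ s)
    (hs : ∀ u ∈ s, p u ∈ s) :
    levelBound d f #s ≤ ∑ u, f (G.degree u) * #(ancestors p u \ s) := by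
  have hn : Fintype.card V = n := by simpa using (Fintype.card_congr e).symm
  rw [sum_mul_eq_sum_levels _ _ (n := n) fun u => (card_le_univ _).trans hn.le, levelBound]
  refine sum_le_sum fun l _ => ?_
  rw [sum_degree_eq he f]
  refine sub_le_sub_left ((sum_degree_le_sum_initial hd he hf _).trans ?_) _
  refine sum_le_sum_of_subset_of_nonneg ?_ fun i _ _ => hf0 _
  exact monotone_filter_right _ fun i _ hi =>
    lt_of_lt_of_le hi (h.card_level_le hd he hpos hr hs l)

end IsParentMap

/-! ### The greedy tree -/

section Greedy

variable {n : ℕ} {d : Fin n → ℕ}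

theorem greedyChildCount_antitone (hd : Antitone d) : Antitone (greedyChildCount d) := by
  intro i j hij
  have := hd hij
  unfold greedyChildCount
  rw [Fin.le_def] at hij
  split_ifs <;> omega

/-- The queue never empties early. If vertex m has no children, neither has any later one, so all n
labels are already given out; otherwise each of the m earlier vertices has a child. -/
theorem lt_greedyLabelled (hd : Antitone d) (hn : greedyLabelled d n = n) {m : ℕ} (hm : m < n) :
    m < greedyLabelled d m := by
  by_contra! hle
  have hc := greedyChildCount_antitone hd
  by_cases hz : greedyChildCount d ⟨m, hm⟩ = 0
  · have : greedyLabelled d n = greedyLabelled d m := by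
      unfold greedyLabelled
      congr 1
      symm
      refine sum_subset (fun i hi => by simp) fun i _ hi => ?_
      rw [mem_filter_univ, not_lt] at hi
      exact Nat.eq_zero_of_le_zero (hz ▸ hc (a := ⟨m, hm⟩) (b := i) hi)
    omega
  · have h1 : #{i : Fin n | i.val < m} • 1 ≤
        ∑ i with i.val < m, greedyChildCount d i := by
      refine card_nsmul_le_sum _ _ _ fun i hi => ?_
      rw [mem_filter_univ] at hi
      have := hc (a := i) (b := ⟨m, hm⟩) hi.le
      omega
    rw [Fin.card_filter_val_lt, min_eq_right hm.le] at h1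
    unfold greedyLabelled at hle
    simp only [smul_eq_mul, mul_one] at h1
    omega

theorem lt_of_greedyFirstChild_le (hd : Antitone d) (hn : greedyLabelled d n = n) {i k : Fin n}
    (h : greedyFirstChild d i ≤ (k : ℕ)) : i < k := by
  rw [greedyFirstChild_eq] at h
  exact (lt_greedyLabelled hd hn i.is_lt).trans_le h

variable [NeZero n]

theorem greedyLabelled_eq_card (hpos : ∀ i : Fin n, i.val ≠ 0 → 1 ≤ d i)
    (hsum : ∑ i, d i + 2 = 2 * n) : greedyLabelled d n = n := by
  have := greedyLabelled_eq d hpos NeZero.one_le le_rfl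
  simp only [Fin.is_lt, filter_true] at this
  omega

theorem exists_greedyParent (hn : greedyLabelled d n = n) (k : Fin n) (hk : k ≠ 0) :
    ∃ i, greedyFirstChild d i ≤ (k : ℕ) ∧
      (k : ℕ) < greedyFirstChild d i + greedyChildCount d i := by
  -- The last vertex processed before this first m is the parent: its turn is when the label k is
  -- handed out.
  have hex : ∃ m, k.val < greedyLabelled d m := ⟨n, hn.symm ▸ k.is_lt⟩
  have h1 := Nat.find_spec hex
  have h2 : Nat.find hex ≤ n := Nat.find_min' hex (hn.symm ▸ k.is_lt)
  have h3 := fun m => Nat.find_min hex (m := m)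
  generalize Nat.find hex = m at h1 h2 h3
  cases m with
  | zero =>
    exfalso
    simp [greedyLabelled] at h1
    exact hk h1
  | succ i =>
    refine ⟨⟨i, h2⟩, ?_, ?_⟩
    · rw [greedyFirstChild_eq]
      exact not_lt.1 (h3 i (Nat.lt_succ_self i))
    · rw [greedyFirstChild_eq, ← greedyLabelled_succ]
      exact h1

open Classical in
/-- The parent of a vertex in the greedy tree. -/
noncomputable def greedyParent (d : Fin n → ℕ) (k : Fin n) : Fin n :=
  if h : k ≠ 0 ∧ ∃ i, greedyFirstChild d i ≤ (k : ℕ) ∧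
      (k : ℕ) < greedyFirstChild d i + greedyChildCount d i then h.2.choose else 0

/-- The children of i carry the labels from `greedyLabelled d i` up to, but excluding,
`greedyLabelled d (i + 1)`; these intervals are disjoint, so the parent is unique. -/
theorem greedyParent_eq_iff (hn : greedyLabelled d n = n) {k : Fin n} (hk : k ≠ 0) (i : Fin n) :
    greedyParent d k = i ↔ greedyFirstChild d i ≤ (k : ℕ) ∧
      (k : ℕ) < greedyFirstChild d i + greedyChildCount d i := by
  have hspec : greedyFirstChild d (greedyParent d k) ≤ (k : ℕ) ∧
      (k : ℕ) < greedyFirstChild d (greedyParent d k) + greedyChildCount d (greedyParent d k) := by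
    have h := exists_greedyParent hn k hk
    rw [greedyParent, dif_pos ⟨hk, h⟩]
    exact h.choose_spec
  constructor
  · rintro rfl
    exact hspec
  · generalize greedyParent d k = j at hspec
    simp only [greedyFirstChild_eq, ← greedyLabelled_succ] at hspec ⊢
    intro h
    rcases lt_trichotomy j i with hlt | heq | hlt
    · have := greedyLabelled_mono d (Nat.add_one_le_iff.2 (Fin.lt_def.1 hlt))
      omega
    · exact heq
    · have := greedyLabelled_mono d (Nat.add_one_le_iff.2 (Fin.lt_def.1 hlt))
      omega

theorem ne_zero_of_greedyFirstChild_le {i k : Fin n} (h : greedyFirstChild d i ≤ (k : ℕ)) :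
    k ≠ 0 := by
  rintro rfl
  simp [greedyFirstChild] at h

theorem greedyTree_isParentMap (hd : Antitone d) (hn : greedyLabelled d n = n) :
    IsParentMap (greedyTree d) 0 (greedyParent d) Fin.val where
  map_root := by simp [greedyParent]
  rank_lt k hk := lt_of_greedyFirstChild_le hd hn ((greedyParent_eq_iff hn hk _).1 rfl).1
  adj_iff i k := by
    have key : ∀ i k : Fin n, (greedyFirstChild d i ≤ (k : ℕ) ∧
        (k : ℕ) < greedyFirstChild d i + greedyChildCount d i) ↔ k ≠ 0 ∧ greedyParent d k = i := by
      intro i k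
      constructor
      · intro h
        have hk : k ≠ 0 := ne_zero_of_greedyFirstChild_le h.1
        exact ⟨hk, (greedyParent_eq_iff hn hk i).2 h⟩
      · rintro ⟨hk, h⟩
        exact (greedyParent_eq_iff hn hk i).1 h
    rw [greedyTree, SimpleGraph.fromRel_adj, ← key, ← key, or_comm]
    refine and_iff_right_of_imp ?_
    rintro (h | h)
    · exact (lt_of_greedyFirstChild_le hd hn h.1).ne'
    · exact (lt_of_greedyFirstChild_le hd hn h.1).ne

theorem greedyTree_degree (hd : Antitone d) (hpos : ∀ i : Fin n, i.val ≠ 0 → 1 ≤ d i)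
    (hn : greedyLabelled d n = n) (i : Fin n) : (greedyTree d).degree i = d i := by
  rw [(greedyTree_isParentMap hd hn).degree_eq]
  have hch : #{k | k ≠ 0 ∧ greedyParent d k = i} = greedyChildCount d i := by
    have h1 : ({k | k ≠ 0 ∧ greedyParent d k = i} : Finset (Fin n)).map Fin.valEmbedding =
        Ico (greedyFirstChild d i) (greedyFirstChild d i + greedyChildCount d i) := by
      ext m
      rw [mem_map, mem_Ico]
      constructor
      · rintro ⟨k, hk, rfl⟩
        rw [mem_filter_univ] at hk
        exact (greedyParent_eq_iff hn hk.1 i).1 hk.2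
      · intro h
        have hm : m < n := by
          refine h.2.trans_le ?_
          rw [greedyFirstChild_eq, ← greedyLabelled_succ]
          exact (greedyLabelled_mono d i.is_lt).trans hn.le
        have hk : (⟨m, hm⟩ : Fin n) ≠ 0 :=
          ne_zero_of_greedyFirstChild_le (k := ⟨m, hm⟩) h.1
        refine ⟨⟨m, hm⟩, ?_, rfl⟩
        rw [mem_filter_univ]
        exact ⟨hk, (greedyParent_eq_iff hn hk i).2 h⟩
    rw [← card_map Fin.valEmbedding, h1, Nat.card_Ico]
    omega
  rw [hch, greedyChildCount]
  have hi0 : (i : ℕ) = 0 ↔ i = 0 := Fin.val_eq_zero_iff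
  by_cases hi : i = 0
  · rw [if_pos (hi0.2 hi), if_pos hi, add_zero]
  · rw [if_neg (fun h => hi (hi0.1 h)), if_neg hi]
    have := hpos i fun h => hi (hi0.1 h)
    omega

theorem greedyTree_isTree (hd : Antitone d) (hpos : ∀ i : Fin n, i.val ≠ 0 → 1 ≤ d i)
    (hsum : ∑ i, d i + 2 = 2 * n) : (greedyTree d).IsTree := by
  have hn := greedyLabelled_eq_card hpos hsum
  refine SimpleGraph.isTree_iff_connected_and_card.2
    ⟨(greedyTree_isParentMap hd hn).connected, ?_⟩
  have h := (greedyTree d).sum_degrees_eq_twice_card_edges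
  simp only [greedyTree_degree hd hpos hn] at h
  rw [Nat.card_eq_fintype_card, Nat.card_eq_fintype_card, ← SimpleGraph.edgeFinset_card,
    Fintype.card_fin]
  omega

/-- Counterpart of `card_level_le`: by monotonicity, a label below `greedyLabelled d m` has its
parent below m, so each iterate costs at most one level. -/
theorem greedyTree_level_le (hd : Antitone d) (hn : greedyLabelled d n = n) {j : ℕ} (hj : 1 ≤ j)
    (l : ℕ) (u : Fin n) (hu : u.val < (greedyLabelled d)^[l] j) :
    #(ancestors (greedyParent d) u \ ({i | i.val < j} : Finset (Fin n))) ≤ l := by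
  have h := greedyTree_isParentMap hd hn
  have hs : ∀ v ∈ ({i | i.val < j} : Finset (Fin n)),
      greedyParent d v ∈ ({i | i.val < j} : Finset (Fin n)) := by
    intro v hv
    rw [mem_filter_univ] at hv ⊢
    exact (h.rank_le (mem_ancestors.2 ⟨1, rfl⟩)).trans_lt hv
  induction l generalizing u with
  | zero =>
    refine (IsParentMap.level_eq_zero hs ?_).le
    rw [mem_filter_univ]
    exact hu
  | succ l ih =>
    by_cases huj : u ∈ ({i | i.val < j} : Finset (Fin n))
    · rw [IsParentMap.level_eq_zero hs huj]
      exact Nat.zero_le _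
    · have h0 : (0 : Fin n) ∈ ({i | i.val < j} : Finset (Fin n)) := by
        rw [mem_filter_univ]
        exact hj
      have hu0 : u ≠ 0 := by
        rintro rfl
        exact huj h0
      rw [← h.level_parent_lt huj h0]
      refine Nat.succ_le_succ (ih _ ?_)
      rw [Function.iterate_succ_apply'] at hu
      by_contra! hle
      have h1 := ((greedyParent_eq_iff hn hu0 _).1 rfl).1
      rw [greedyFirstChild_eq] at h1
      have h2 := greedyLabelled_mono d hle
      omega

theorem greedyTree_sum_level_le (hd : Antitone d) (hpos : ∀ i : Fin n, i.val ≠ 0 → 1 ≤ d i)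
    (hn : greedyLabelled d n = n) {f : ℕ → ℝ} (hf0 : ∀ m, 0 ≤ f m) {j : ℕ} (hj : 1 ≤ j) :
    ∑ u, f ((greedyTree d).degree u) *
      #(ancestors (greedyParent d) u \ ({i | i.val < j} : Finset (Fin n))) ≤ levelBound d f j := by
  rw [sum_mul_eq_sum_levels _ _ (n := n)
    fun u => (card_le_univ _).trans (Fintype.card_fin n).le, levelBound]
  simp only [greedyTree_degree hd hpos hn]
  refine sum_le_sum fun l _ => sub_le_sub_left ?_ _
  exact sum_le_sum_of_subset_of_nonneg
    (monotone_filter_right _ fun u _ hu => greedyTree_level_le hd hn hj l u hu) fun i _ _ => hf0 _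

end Greedy

/-! ### Rooting a tree at its centroid -/

/-- The parent is a neighbour closer to the root. The edges from non-root vertices to their parents
are distinct and as many as the tree has, hence they are all its edges. -/
theorem SimpleGraph.IsTree.exists_isParentMap {V : Type*} [Fintype V] {G : SimpleGraph V}
    (hG : G.IsTree) (r : V) : ∃ p, IsParentMap G r p (G.dist r) := by
  classical
  have hstep : ∀ v, v ≠ r → ∃ w, G.Adj v w ∧ G.dist r w < G.dist r v := by
    intro v hv
    obtain ⟨q, hq⟩ := hG.connected.exists_walk_length_eq_dist v r
    cases q with
    | nil => exact absurd rfl hv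
    | @cons _ w _ hvw q =>
      refine ⟨w, hvw, ?_⟩
      rw [G.dist_comm (u := r) (v := w), G.dist_comm (u := r) (v := v), ← hq,
        SimpleGraph.Walk.length_cons]
      exact Nat.lt_succ_of_le (SimpleGraph.dist_le q)
  choose! p hp using hstep
  refine ⟨fun v => if v = r then r else p v, ?_, fun v hv => ?_, ?_⟩
  · exact if_pos rfl
  · simpa only [if_neg hv] using (hp v hv).2
  have hinj : Set.InjOn (fun v => s(v, p v)) (univ.erase r : Finset V) := by
    intro v hv w hw hvw
    rw [mem_coe, mem_erase] at hv hw
    rcases Sym2.eq_iff.1 hvw with h | ⟨h1, h2⟩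
    · exact h.1
    · have h3 := (hp v hv.1).2
      have h4 := (hp w hw.1).2
      rw [h2] at h3
      rw [← h1] at h4
      exact absurd h3 h4.asymm
  have himg : (univ.erase r).image (fun v => s(v, p v)) = G.edgeFinset := by
    refine eq_of_subset_of_card_le (fun x hx => ?_) ?_
    · obtain ⟨v, hv, rfl⟩ := mem_image.1 hx
      rw [SimpleGraph.mem_edgeFinset, SimpleGraph.mem_edgeSet]
      exact (hp v (ne_of_mem_erase hv)).1
    · have := hG.card_edgeFinset
      rw [card_image_of_injOn hinj, card_erase_of_mem (mem_univ r), card_univ]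
      omega
  intro u v
  rw [← SimpleGraph.mem_edgeSet, ← SimpleGraph.mem_edgeFinset, ← himg, mem_image]
  constructor
  · rintro ⟨w, hw, h⟩
    have hw := ne_of_mem_erase hw
    rcases Sym2.eq_iff.1 h with ⟨rfl, h⟩ | ⟨rfl, h⟩
    · exact Or.inl ⟨hw, by rwa [if_neg hw]⟩
    · exact Or.inr ⟨hw, by rwa [if_neg hw]⟩
  · rintro (⟨hu, h⟩ | ⟨hv, h⟩)
    · rw [if_neg hu] at h
      exact ⟨u, mem_erase.2 ⟨hu, mem_univ _⟩, by rw [h]⟩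
    · rw [if_neg hv] at h
      exact ⟨v, mem_erase.2 ⟨hv, mem_univ _⟩, by rw [h, Sym2.eq_swap]⟩

theorem IsParentMap.dist_parent {V : Type*} [Fintype V] [DecidableEq V] {G : SimpleGraph V}
    {r : V} {p : V → V} {rk : V → ℕ} (h : IsParentMap G r p rk) {u z : V} (hz : z ≠ r)
    (hu : z ∈ ancestors p u) : G.dist (p z) u = G.dist z u + 1 := by
  have hnot : z ∉ symmDiff (ancestors p z) (ancestors p u) := by
    rw [mem_symmDiff]
    have := self_mem_ancestors p z
    tauto
  rw [h.dist_eq, h.dist_eq, ← card_insert_of_notMem hnot]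
  congr 1
  ext x
  rw [mem_insert, mem_symmDiff, mem_symmDiff, mem_ancestors_iff (u := z)]
  have := h.notMem_ancestors_parent hz
  by_cases hx : x = z
  · subst hx
    tauto
  · tauto

/-- Take r minimizing the weighted sum of distances. Moving to a child z shortens distances into the
branch at z by one and lengthens the others by at most one, so minimality bounds that branch. Deeper
branches weigh no more. -/
theorem SimpleGraph.IsTree.exists_centroid {V : Type*} [Fintype V] [DecidableEq V]
    {G : SimpleGraph V} (hG : G.IsTree) {ω : V → ℝ} (hω : ∀ u, 0 ≤ ω u) :
    ∃ r p, IsParentMap G r p (G.dist r) ∧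
      ∀ z, z ≠ r → 2 * branchWeight p ω z ≤ ∑ u, ω u := by
  have := hG.connected.nonempty
  obtain ⟨r, -, hr⟩ := exists_min_image univ (fun v => ∑ u, ω u * (G.dist v u : ℝ)) univ_nonempty
  obtain ⟨p, h⟩ := hG.exists_isParentMap r
  refine ⟨r, p, h, h.induction (fun hrr => absurd rfl hrr) fun z hz ih _ => ?_⟩
  by_cases hpz : p z = r
  · have hle : ∀ u, ω u * (G.dist z u : ℝ) ≤
        ω u * (G.dist r u : ℝ) + ω u - 2 * if z ∈ ancestors p u then ω u else 0 := by
      intro u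
      by_cases hu : z ∈ ancestors p u
      · have h1 := h.dist_parent hz hu
        rw [hpz] at h1
        rw [h1, if_pos hu]
        push_cast
        linarith
      · have hadj : G.Adj z r := (h.adj_iff z r).2 (Or.inl ⟨hz, hpz⟩)
        have h1 := hG.connected.dist_triangle (u := z) (v := r) (w := u)
        rw [SimpleGraph.dist_eq_one_iff_adj.2 hadj] at h1
        have h2 : (G.dist z u : ℝ) ≤ 1 + G.dist r u := by exact_mod_cast h1
        have := mul_le_mul_of_nonneg_left h2 (hω u)
        rw [if_neg hu]
        linarith
    have h1 := sum_le_sum fun u (_ : u ∈ univ) => hle u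
    rw [sum_sub_distrib, sum_add_distrib, ← mul_sum] at h1
    have h2 := hr z (mem_univ z)
    change _ ≤ _ - 2 * branchWeight p ω z at h1
    linarith
  · have := branchWeight_mono hω (mem_ancestors.2 ⟨1, rfl⟩ : p z ∈ ancestors p z)
    have := ih hpz
    linarith

/-! ### Comparison with the greedy tree -/

theorem leafWeight_nonneg {V : Type*} [Fintype V] {a b : ℝ} (ha : 0 ≤ a) (hb : 0 ≤ b)
    (G : SimpleGraph V) [DecidableRel G.Adj] (u : V) : 0 ≤ leafWeight a b G u := by
  unfold leafWeight
  split_ifs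
  exacts [ha, hb]

theorem IsParentMap.weightedWiener_eq {V : Type*} [Fintype V] [DecidableEq V]
    {G : SimpleGraph V} [DecidableRel G.Adj] {r : V} {p : V → V} {rk : V → ℕ}
    (h : IsParentMap G r p rk) (a b : ℝ) :
    weightedWiener a b G = ∑ z, branchWeight p (leafWeight a b G) z *
      (∑ u, leafWeight a b G u - branchWeight p (leafWeight a b G) z) := by
  rw [weightedWiener, h.sum_mul_dist_eq]
  ring

theorem excessWeight_nonneg {a b : ℝ} (ha : 0 ≤ a) (hb : 0 ≤ b) (m : ℕ) :
    0 ≤ excessWeight a b m :=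
  le_of_eq_of_le (by simp [excessWeight]) (excessWeight_mono ha hb (Nat.zero_le m))

section Comparison

variable {V : Type*} [Fintype V] {G : SimpleGraph V} {n : ℕ} {d : Fin n → ℕ} {e : Fin n ≃ V}

/-- The vertices of a rooted tree can be listed by decreasing branch weight, parents before their
children. -/
theorem IsParentMap.exists_equiv [DecidableEq V] {r : V} {p : V → V} {rk : V → ℕ}
    (h : IsParentMap G r p rk) (e : Fin n ≃ V) {ω : V → ℝ} (hω : ∀ u, 0 ≤ ω u) :
    ∃ e' : Fin n ≃ V, (Antitone fun i => branchWeight p ω (e' i)) ∧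
      ∀ v, v ≠ r → e'.symm (p v) < e'.symm v := by
  -- A parent and its child may have equal branch weights when some vertices weigh zero; the rank
  -- then puts the parent first.
  set key : V → ℝ ×ₗ ℕ := fun v => toLex (-branchWeight p ω v, rk v) with hkey
  have hmono : Monotone (key ∘ (Tuple.sort (key ∘ e)).trans e) := Tuple.monotone_sort (key ∘ e)
  refine ⟨(Tuple.sort (key ∘ e)).trans e, fun i j hij => ?_, fun v hv => ?_⟩
  · have := Prod.Lex.monotone_fst _ _ (hmono hij)
    exact neg_le_neg_iff.1 this
  · have hlt : key (p v) < key v := by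
      rw [hkey, Prod.Lex.toLex_lt_toLex]
      have h1 := branchWeight_mono hω (mem_ancestors.2 ⟨1, rfl⟩ : p v ∈ ancestors p v)
      rcases h1.lt_or_eq with h1 | h1
      · exact Or.inl (neg_lt_neg h1)
      · exact Or.inr ⟨congrArg Neg.neg h1.symm, h.rank_lt v hv⟩
    refine hmono.reflect_lt ?_
    simpa using hlt

variable [DecidableRel G.Adj]

theorem sum_degree_of_isTree (hG : G.IsTree) (he : ∀ i, G.degree (e i) = d i) :
    ∑ i, d i + 2 = 2 * n := by
  have h1 := G.sum_degrees_eq_twice_card_edges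
  have h2 := hG.card_edgeFinset
  have hn : Fintype.card V = n := by simpa using (Fintype.card_congr e).symm
  rw [sum_degree_eq he (fun m => m)] at h1
  omega

variable [DecidableEq V]

theorem one_le_degree_of_isTree (hG : G.IsTree) (he : ∀ i, G.degree (e i) = d i) (i : Fin n)
    (hi : i.val ≠ 0) : 1 ≤ d i := by
  obtain ⟨p, h⟩ := hG.exists_isParentMap (e ⟨0, by omega⟩)
  rw [← he, h.degree_eq, if_neg]
  · omega
  · rw [e.apply_eq_iff_eq]
    exact fun h0 => hi (congrArg Fin.val h0)

/-- Branch weights, listed as in `IsParentMap.exists_equiv`, have tail sums at least as large as in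
the greedy tree. -/
theorem tail_greedyTree_le [NeZero n] (hd : Antitone d) (hG : G.IsTree)
    (he : ∀ i, G.degree (e i) = d i) {a b : ℝ} (ha : 0 ≤ a) (hb : 0 ≤ b) {r : V} {p : V → V}
    {rk : V → ℕ} (h : IsParentMap G r p rk) {e' : Fin n ≃ V} (hr : e' 0 = r)
    (he' : ∀ v, v ≠ r → e'.symm (p v) < e'.symm v) {j : ℕ} (hj : 1 ≤ j) (hjn : j ≤ n) :
    ∑ i with j ≤ Fin.val i,
        branchWeight (greedyParent d) (leafWeight a b (greedyTree d)) i ≤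
      ∑ i with j ≤ Fin.val i, branchWeight p (leafWeight a b G) (e' i) := by
  have hpos := one_le_degree_of_isTree hG he
  have hn := greedyLabelled_eq_card hpos (sum_degree_of_isTree hG he)
  have hgr := greedyTree_isParentMap hd hn
  set t : Finset (Fin n) := {i | i.val < j} with ht
  have htc : ({i | j ≤ Fin.val i} : Finset (Fin n)) = tᶜ := by
    ext i
    simp [ht]
  have ht0 : (0 : Fin n) ∈ t := by
    rw [ht, mem_filter_univ]
    exact hj
  have htcard : #t = j := by
    rw [ht, Fin.card_filter_val_lt, min_eq_right hjn]
  set s : Finset V := t.map e'.toEmbedding with hs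
  have hsc : sᶜ = tᶜ.map e'.toEmbedding := by
    ext v
    simp [hs, mem_map_equiv]
  have hrs : r ∈ s := by
    rw [hs, mem_map_equiv, ← hr, e'.symm_apply_apply]
    exact ht0
  have hclosed : ∀ u ∈ s, p u ∈ s := by
    intro u hu
    by_cases hur : u = r
    · rw [hur, h.map_root]
      exact hrs
    · rw [hs, mem_map_equiv, ht, mem_filter_univ] at hu ⊢
      exact (Fin.lt_def.1 (he' u hur)).trans hu
  have h1 := hgr.sum_branchWeight_compl a b ht0
  have h2 := h.sum_branchWeight_compl a b hrs
  -- The `a`-terms agree on both sides, as the complements have equal size; `levelBound` separates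
  -- the remaining sums.
  have h3 := greedyTree_sum_level_le hd hpos hn (excessWeight_nonneg ha hb) hj
  have h4 := h.levelBound_le hd he hpos (excessWeight_mono ha hb) (excessWeight_nonneg ha hb)
    hrs hclosed
  have h5 : #s = j := by rw [hs, card_map, htcard]
  rw [h5] at h4
  rw [hsc, sum_map, card_map] at h2
  rw [htc, h1]
  refine le_of_le_of_eq ?_ h2.symm
  exact add_le_add_right (h3.trans h4) _

/-- Concavity of t(S - t) turns the comparison of tail sums into a comparison of indices; the
centroid bound for T makes the slopes S - 2y nonnegative, and the ordering makes them monotone. -/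
theorem weightedWiener_greedyTree_le (hd : Antitone d) (hG : G.IsTree)
    (he : ∀ i, G.degree (e i) = d i) {a b : ℝ} (ha : 0 ≤ a) (hb : 0 ≤ b) :
    weightedWiener a b (greedyTree d) ≤ weightedWiener a b G := by
  have hω := leafWeight_nonneg ha hb G
  obtain ⟨r, p, h, hcent⟩ := hG.exists_centroid hω
  have : NeZero n := ⟨by
    rintro rfl
    exact (e.symm r).elim0⟩
  have hpos := one_le_degree_of_isTree hG he
  have hn := greedyLabelled_eq_card hpos (sum_degree_of_isTree hG he)
  have hgr := greedyTree_isParentMap hd hn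
  obtain ⟨e', hanti, he'⟩ := h.exists_equiv e hω
  have hr : e' 0 = r := by
    by_contra hne
    have := he' _ hne
    rw [e'.symm_apply_apply] at this
    simp at this
  have hS : ∑ i, leafWeight a b (greedyTree d) i = ∑ u, leafWeight a b G u := by
    unfold leafWeight
    rw [sum_degree_eq he fun m => if m = 1 then a else b]
    simp only [greedyTree_degree hd hpos hn]
  have hy0 : branchWeight p (leafWeight a b G) (e' 0) = ∑ u, leafWeight a b G u := by
    rw [hr, h.branchWeight_root]
  have hx0 : branchWeight (greedyParent d) (leafWeight a b (greedyTree d)) 0 =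
      ∑ u, leafWeight a b G u := by
    rw [hgr.branchWeight_root, hS]
  have htail := fun j hj hjn => tail_greedyTree_le hd hG he ha hb h hr he' (j := j) hj hjn
  have hcent' : ∀ i : Fin n, i ≠ 0 →
      2 * branchWeight p (leafWeight a b G) (e' i) ≤ ∑ u, leafWeight a b G u := by
    intro i hi
    apply hcent
    rw [← hr]
    exact fun hh => hi (e'.injective hh)
  rw [hgr.weightedWiener_eq, h.weightedWiener_eq, hS]
  generalize (∑ u, leafWeight a b G u) = S at *
  generalize branchWeight (greedyParent d) (leafWeight a b (greedyTree d)) = x at *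
  rw [← e'.sum_comp]
  generalize hy : (fun i => branchWeight p (leafWeight a b G) (e' i)) = y at *
  simp only [funext_iff] at hy
  simp only [hy] at *
  -- At the root y = x = S, so its coefficient is free; 0 replaces the slope -S to keep the sequence
  -- nonnegative and monotone.
  have habel := sum_mul_nonneg_of_tails (c := fun i => if i = 0 then 0 else S - 2 * y i)
    (g := fun i => y i - x i) ?_ ?_ ?_
  · rw [← sub_nonneg, ← sum_sub_distrib]
    refine habel.trans (sum_le_sum fun i _ => ?_)
    by_cases hi : i = 0
    · rw [if_pos hi, hi, hx0, hy0]
      simp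
    · rw [if_neg hi]
      -- The difference of the two sides is exactly (y - x)².
      nlinarith [sq_nonneg (y i - x i)]
  · intro i k hik
    by_cases hi : i = 0
    · by_cases hk : k = 0
      · simp [hi, hk]
      · simp only [if_pos hi, if_neg hk]
        linarith [hcent' k hk]
    · have hk : k ≠ 0 := by
        rintro rfl
        exact hi (by simpa using hik)
      simp only [if_neg hi, if_neg hk]
      linarith [hanti hik]
  · intro i
    by_cases hi : i = 0
    · simp [hi]
    · simp only [if_neg hi]
      linarith [hcent' i hi]
  · intro j hj
    have hone : ∀ j, 1 ≤ j → j ≤ n → 0 ≤ ∑ i with j ≤ Fin.val i, (y i - x i) := by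
      intro j hj hjn
      rw [sum_sub_distrib, sub_nonneg]
      exact htail j hj hjn
    rcases Nat.eq_zero_or_pos j with rfl | hj0
    -- The tail from 0 equals the tail from 1, because the root terms cancel.
    · refine (hone 1 le_rfl NeZero.one_le).trans_eq (sum_subset (fun i _ => by simp) ?_)
      intro i _ hi
      rw [mem_filter_univ, not_le, Nat.lt_one_iff, Fin.val_eq_zero_iff] at hi
      rw [hi, hx0, hy0, sub_self]
    · exact hone j hj0 hj.le

end Comparison

theorem terminalWiener_eq {V : Type*} [Fintype V] (G : SimpleGraph V) [DecidableRel G.Adj] :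
    terminalWiener G = weightedWiener 1 0 G := by
  simp only [terminalWiener, weightedWiener, leafWeight, sum_filter, mul_ite, ite_mul, one_mul,
    zero_mul, mul_one, mul_zero]
  congr 1
  refine sum_congr rfl fun v _ => ?_
  split_ifs <;> simp

theorem spinalWiener_eq {V : Type*} [Fintype V] (G : SimpleGraph V) [DecidableRel G.Adj] :
    spinalWiener G = weightedWiener 0 1 G := by
  simp only [spinalWiener, weightedWiener, leafWeight, sum_filter, ite_not, mul_ite, ite_mul,
    one_mul, zero_mul, mul_one, mul_zero]
  congr 1
  refine sum_congr rfl fun v _ => ?_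
  split_ifs <;> simp

theorem mainTheorem8 {n : ℕ} (d : Fin n → ℕ) (hd : Antitone d)
    {V : Type*} [Fintype V] (T : SimpleGraph V) [DecidableRel T.Adj]
    (hT : T.IsTree) (hTd : HasDegreeSequence T d) :
    (greedyTree d).IsTree ∧ HasDegreeSequence (greedyTree d) d ∧
    (∀ a b : ℝ, 0 < a → 0 < b →
      weightedWiener a b (greedyTree d) ≤ weightedWiener a b T) ∧
    (∀ a : ℝ, 0 < a → weightedWiener a 0 (greedyTree d) ≤ weightedWiener a 0 T) ∧
    (∀ b : ℝ, 0 < b → weightedWiener 0 b (greedyTree d) ≤ weightedWiener 0 b T) ∧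
    terminalWiener (greedyTree d) ≤ terminalWiener T ∧
    spinalWiener (greedyTree d) ≤ spinalWiener T := by
  classical
  obtain ⟨e, he⟩ := hTd
  have : NeZero n := ⟨by
    rintro rfl
    obtain ⟨v⟩ := hT.connected.nonempty
    exact (e.symm v).elim0⟩
  have hpos := one_le_degree_of_isTree hT he
  have hsum := sum_degree_of_isTree hT he
  have key : ∀ a b : ℝ, 0 ≤ a → 0 ≤ b →
      weightedWiener a b (greedyTree d) ≤ weightedWiener a b T :=
    fun a b ha hb => weightedWiener_greedyTree_le hd hT he ha hb
  refine ⟨greedyTree_isTree hd hpos hsum,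
    ⟨Equiv.refl _, greedyTree_degree hd hpos (greedyLabelled_eq_card hpos hsum)⟩,
    fun a b ha hb => key a b ha.le hb.le, fun a ha => key a 0 ha.le le_rfl,
    fun b hb => key 0 b le_rfl hb.le, ?_, ?_⟩
  · rw [terminalWiener_eq, terminalWiener_eq]
    exact key 1 0 zero_le_one le_rfl
  · rw [spinalWiener_eq, spinalWiener_eq]
    exact key 0 1 le_rfl zero_le_one
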